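/- All manifolds and maps are $C^\infty$. Let $G$ be a (finite-dimensional real) Lie group with multiplication $\mu(g,h)=gh$ and identity $e$, let $U\subseteq G$ be an open neighbourhood of $e$, let $M$ be an $m$-dimensional manifold, let $p:U\to M$ be a fibration (a surjective submersion; in particular any locally trivial smooth fibre bundle is allowed), and put $x_0=p(e)$. Let $\sigma:V\to U$ be a smooth section of $p$ (that is, $p(\sigma(x))=x$ for all $x\in V$) on an open neighbourhood $V$ of $x_0$, with $\sigma(x_0)=e$. Then the following are equivalent. (a) $\sigma$ satisfies the differential equation $$D\sigma(x)\cdot Dp(\sigma(x))\cdot D_2\mu(\sigma(x),e)\cdot D\sigma(x_0)=D_2\mu(\sigma(x),e)\cdot D\sigma(x_0)$$ (an identity of linear maps $T_{x_0}M\to T_{\sigma(x)}G$) for all $x$ in some open neighbourhood $W\subseteq V$ of $x_0$. (b) There is an open neighbourhood $W\subseteq V$ of $x_0$ such that for all $x,y\in W$ one has $\sigma(x)\sigma(y)\in U$, $p(\sigma(x)\sigma(y))\in V$ and $$\sigma(p(\sigma(x)\sigma(y)))=\sigma(x)\sigma(y).$$ In particular, any local solution $\sigma$ of the differential equation with $\sigma(x_0)=e$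 is a local solution of the functional equation. -/

import Mathlib

open scoped Manifold ContDiff Topology

section LocalHomomorphisms

variable (n m : ℕ)
  {G : Type*} [TopologicalSpace G] [ChartedSpace (EuclideanSpace ℝ (Fin n)) G] [Group G]
  {M : Type*} [TopologicalSpace M] [ChartedSpace (EuclideanSpace ℝ (Fin m)) M]

/-- `p` restricts to a smooth fibration from the open set `U ⊆ G` onto the manifold `M`:
a smooth surjective submersion. (Every smooth locally trivial fibre bundle is one.)
The values of `p` outside `U` play no role. -/
structure IsSmoothFibrationOn (U : Set G) (p : G → M) : Prop where
  contMDiffOn : ContMDiffOn (𝓡 n) (𝓡 m) ∞ p U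
  surjOn : Set.SurjOn p U Set.univ
  submersion : ∀ g ∈ U, Function.Surjective (mfderiv (𝓡 n) (𝓡 m) p g)

/-- `σ` restricts to a smooth section, over the open set `V ⊆ M`, of `p : U → M`.
The values of `σ` outside `V` play no role. -/
structure IsSmoothSectionOn (U : Set G) (p : G → M) (V : Set M) (σ : M → G) : Prop where
  contMDiffOn : ContMDiffOn (𝓡 m) (𝓡 n) ∞ σ V
  mapsTo : Set.MapsTo σ V U
  rightInv : ∀ x ∈ V, p (σ x) = x

/-- The differential equation at the point `x`, as an identity of linear maps on `T_{x₀} M`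
(evaluated at an arbitrary tangent vector `ξ`):
`Dσ(x) · Dp(σ(x)) · D₂μ(σ(x), e) · Dσ(x₀) = D₂μ(σ(x), e) · Dσ(x₀)`,
where `μ(g, h) = g * h`. It is meaningful for sections `σ` of `p` near `x₀` and `x` with
`σ x₀ = e`, so that the foot points of the tangent vectors match. -/
def DifferentialEquationAt (p : G → M) (σ : M → G) (x₀ x : M) : Prop :=
  ∀ ξ : TangentSpace (𝓡 m) x₀,
    mfderiv (𝓡 m) (𝓡 n) σ x
      (mfderiv (𝓡 n) (𝓡 m) p (σ x)
        (mfderiv (𝓡 n) (𝓡 n) (fun h : G => σ x * h) 1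
          (mfderiv (𝓡 m) (𝓡 n) σ x₀ ξ))) =
    mfderiv (𝓡 n) (𝓡 n) (fun h : G => σ x * h) 1 (mfderiv (𝓡 m) (𝓡 n) σ x₀ ξ)

/-- `σ` solves the differential equation near `x₀`, on a neighbourhood inside its domain `V`. -/
def SolvesDifferentialEquationNear (p : G → M) (V : Set M) (σ : M → G) (x₀ : M) : Prop :=
  ∃ W : Set M, IsOpen W ∧ x₀ ∈ W ∧ W ⊆ V ∧ ∀ x ∈ W, DifferentialEquationAt n m p σ x₀ x

end LocalHomomorphisms

/-- `σ` solves the functional equation `σ(p(σ(x)σ(y))) = σ(x)σ(y)` for all `x`, `y` near `x₀`,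
where both sides are defined: `σ(x)σ(y)` lies in the domain `U` of `p`, and its image under `p`
in the domain `V` of `σ`. -/
def SolvesFunctionalEquationNear {G M : Type*} [Group G] [TopologicalSpace M]
    (U : Set G) (p : G → M) (V : Set M) (σ : M → G) (x₀ : M) : Prop :=
  ∃ W : Set M, IsOpen W ∧ x₀ ∈ W ∧ W ⊆ V ∧ ∀ x ∈ W, ∀ y ∈ W,
    σ x * σ y ∈ U ∧ p (σ x * σ y) ∈ V ∧ σ (p (σ x * σ y)) = σ x * σ y

/-! By `differentialEquationAt_iff`, the differential equation at `x` says that `y ↦ σ(p(σ(x)σ(y)))`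
and `y ↦ σ(x)σ(y)` have equal derivatives at `x₀`. So the functional equation implies it by
differentiation.

For the converse, work in charts (`eventually_section_mul`). Put `R = s ∘ P`, `B(a) = D₂mul(a, e)`,
`L = Ds(y₀)` and `A(a) = (DR(a) - 1) B(a) L`; the equation says that `A` vanishes on the image of
`s`. It also expresses `Ds(z)` as `B(s z) L T(z)⁻¹`, with `T(y₀) = 1`. For `g = mul(s x, s z)`,
associativity (`eventually_sndFDeriv_comp`) then makes the `z`-derivative of the error `R(g) - g`
equal to `A(g) T(z)⁻¹`. Since `A` is Lipschitz and `A(R(g)) = 0`, this derivative is bounded by a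
multiple of the error itself. The error is zero at `z = y₀`, so Gronwall
(`Convex.eq_zero_of_norm_fderiv_le`) kills it. -/

section Gronwall

/-! ### Gronwall uniqueness on convex sets. -/

open Filter Set

variable {E F : Type*} [NormedAddCommGroup E] [NormedSpace ℝ E]
  [NormedAddCommGroup F] [NormedSpace ℝ F]

/-- A function on a convex set that vanishes at one point and whose derivative is dominated by its
value vanishes identically. -/
theorem Convex.eq_zero_of_norm_fderiv_le {f : F → E} {f' : F → F →L[ℝ] E} {s : Set F}
    (hs : Convex ℝ s) {K : ℝ} (hf : ∀ z ∈ s, HasFDerivAt f (f' z) z)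
    (hK : ∀ z ∈ s, ‖f' z‖ ≤ K * ‖f z‖) {y₀ y : F} (hy₀ : y₀ ∈ s) (hy : y ∈ s) (h0 : f y₀ = 0) :
    f y = 0 := by
  have hmem : ∀ t ∈ Icc (0 : ℝ) 1, AffineMap.lineMap y₀ y t ∈ s := fun t ht =>
    hs.lineMap_mem hy₀ hy ht
  have hd : ∀ t ∈ Icc (0 : ℝ) 1, HasDerivAt (fun t => f (AffineMap.lineMap y₀ y t))
      (f' (AffineMap.lineMap y₀ y t) (y - y₀)) t := fun t ht =>
    (hf _ (hmem t ht)).comp_hasDerivAt t AffineMap.hasDerivAt_lineMap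
  -- Gronwall along the segment from `y₀` to `y`, whose velocity contributes the factor `‖y - y₀‖`;
  -- with `δ = ε = 0` the bound is zero.
  have := norm_le_gronwallBound_of_norm_deriv_right_le (δ := 0) (K := K * ‖y - y₀‖) (ε := 0)
    (fun t ht => (hd t ht).continuousAt.continuousWithinAt)
    (fun t ht => (hd t (Ico_subset_Icc_self ht)).hasDerivWithinAt) (by simp [h0])
    (fun t ht => by
      have ht' := Ico_subset_Icc_self ht
      calc _ ≤ ‖f' (AffineMap.lineMap y₀ y t)‖ * ‖y - y₀‖ := ContinuousLinearMap.le_opNorm _ _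
        _ ≤ K * ‖f (AffineMap.lineMap y₀ y t)‖ * ‖y - y₀‖ := by
          gcongr; exact hK _ (hmem t ht')
        _ = _ := by ring) 1 (by simp)
  simpa [gronwallBound_ε0_δ0] using this

end Gronwall

/-! ### The differential equation in coordinates. -/

section LocalMultiplication

open Filter Set

variable {E F : Type*} [NormedAddCommGroup E] [NormedSpace ℝ E]
  [NormedAddCommGroup F] [NormedSpace ℝ F]

/-- The partial derivative of `mul` in the second variable. -/
noncomputable def sndFDeriv (mul : E × E → E) (q : E × E) : E →L[ℝ] E :=
  (fderiv ℝ mul q).comp (ContinuousLinearMap.inr ℝ E E)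

theorem hasFDerivAt_sndFDeriv {mul : E × E → E} {a b : E}
    (h : DifferentiableAt ℝ mul (a, b)) :
    HasFDerivAt (fun c => mul (a, c)) (sndFDeriv mul (a, b)) b :=
  h.hasFDerivAt.comp b (hasFDerivAt_prodMk_right a b)

/-- Left translation by `mul (a, b)` is the composition of the left translations by `a` and `b`. -/
theorem eventually_sndFDeriv_comp {mul : E × E → E} {e : E}
    (hmul : ∀ᶠ q in 𝓝 (e, e), DifferentiableAt ℝ mul q)
    (hmul_one : ∀ᶠ a in 𝓝 e, mul (a, e) = a)
    (hassoc : ∀ᶠ q : (E × E) × E in 𝓝 ((e, e), e),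
      mul (mul (q.1.1, q.1.2), q.2) = mul (q.1.1, mul (q.1.2, q.2))) :
    ∀ᶠ q : E × E in 𝓝 (e, e),
      (sndFDeriv mul q).comp (sndFDeriv mul (q.2, e)) = sndFDeriv mul (mul q, e) := by
  have hee : mul (e, e) = e := hmul_one.self_of_nhds
  have hc : ContinuousAt mul (e, e) := hmul.self_of_nhds.continuousAt
  have ht : Tendsto (fun q : E × E => (mul q, e)) (𝓝 (e, e)) (𝓝 (e, e)) := by
    have := hc.prodMk (continuousAt_const (y := e))
    simpa [ContinuousAt, hee] using this
  have ht2 : Tendsto (fun q : E × E => (q.2, e)) (𝓝 (e, e)) (𝓝 (e, e)) :=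
    (by fun_prop : Continuous fun q : E × E => (q.2, e)).tendsto' _ _ rfl
  -- Currying gives associativity for all `c` near `e` with `(a, b)` fixed, so it can be
  -- differentiated in `c` at `e`.
  have hassoc' := (nhds_prod_eq (x := (e, e)) (y := e) ▸ hassoc).curry
  have h2 : Tendsto (fun q : E × E => q.2) (𝓝 (e, e)) (𝓝 e) := continuous_snd.tendsto' _ _ rfl
  filter_upwards [hmul, ht.eventually hmul, ht2.eventually hmul, hassoc', h2.eventually hmul_one]
    with q h1 h2 h3 h4 h5
  obtain ⟨a, b⟩ := q
  dsimp only at h2 h3 h4 h5 ⊢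
  have hB := hasFDerivAt_sndFDeriv h3
  have hA : HasFDerivAt (fun c => mul (a, c)) (sndFDeriv mul (a, b)) (mul (b, e)) := by
    rw [h5]; exact hasFDerivAt_sndFDeriv h1
  have hAB : HasFDerivAt (fun c => mul (a, mul (b, c))) _ e :=
    HasFDerivAt.comp (g := fun c => mul (a, c)) e hA hB
  have := hAB.congr_of_eventuallyEq (f₁ := fun c => mul (mul (a, b), c)) h4
  exact this.unique (hasFDerivAt_sndFDeriv h2)

/-- For an associative multiplication in coordinates, a section `s` of `P` that solves the
differential equation is locally closed under multiplication. -/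
theorem eventually_section_mul [CompleteSpace F] {mul : E × E → E} {s : F → E} {P : E → F}
    {e : E} {y₀ : F}
    (hmul : ContDiffAt ℝ 2 mul (e, e)) (hs : ContDiffAt ℝ 2 s y₀) (hP : ContDiffAt ℝ 2 P e)
    (hse : s y₀ = e) (hPs : ∀ᶠ z in 𝓝 y₀, P (s z) = z)
    (hmul_one : ∀ᶠ a in 𝓝 e, mul (a, e) = a) (hone_mul : ∀ᶠ a in 𝓝 e, mul (e, a) = a)
    (hassoc : ∀ᶠ q : (E × E) × E in 𝓝 ((e, e), e),
      mul (mul (q.1.1, q.1.2), q.2) = mul (q.1.1, mul (q.1.2, q.2)))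
    (hDE : ∀ᶠ z in 𝓝 y₀, fderiv ℝ (fun y => s (P (mul (s z, s y)))) y₀ =
      fderiv ℝ (fun y => mul (s z, s y)) y₀) :
    ∀ᶠ q : F × F in 𝓝 (y₀, y₀), s (P (mul (s q.1, s q.2))) = mul (s q.1, s q.2) := by
  subst hse
  have hPy : P (s y₀) = y₀ := hPs.self_of_nhds
  have hee : mul (s y₀, s y₀) = s y₀ := hmul_one.self_of_nhds
  have hsP : ContDiffAt ℝ 2 s (P (s y₀)) := by rwa [hPy]
  have hR : ContDiffAt ℝ 2 (fun a => s (P a)) (s y₀) := hsP.comp _ hP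
  have hB : ContDiffAt ℝ 1 (fun a => sndFDeriv mul (a, s y₀)) (s y₀) := by
    have h1 : ContDiffAt ℝ 1 (fderiv ℝ mul) (s y₀, s y₀) := hmul.fderiv_right (by norm_num)
    have h2 : ContDiffAt ℝ 1 (fun a => fderiv ℝ mul (a, s y₀)) (s y₀) :=
      ContDiffAt.comp (f := fun a => (a, s y₀)) (s y₀) h1 (contDiffAt_id.prodMk contDiffAt_const)
    exact h2.clm_comp contDiffAt_const
  set L := fderiv ℝ s y₀ with hL
  -- The defect of the differential equation, extended off the image of `s` to all `a` near `e`.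
  -- Being `C¹`, it is locally Lipschitz.
  let A : E → F →L[ℝ] E := fun a =>
    (fderiv ℝ (fun a => s (P a)) a - ContinuousLinearMap.id ℝ E).comp
      ((sndFDeriv mul (a, s y₀)).comp L)
  have hA : ContDiffAt ℝ 1 A (s y₀) :=
    ((hR.fderiv_right (by norm_num)).sub contDiffAt_const).clm_comp
      (hB.clm_comp contDiffAt_const)
  obtain ⟨K, t, ht, hKt⟩ := hA.exists_lipschitzOnWith
  have dmul := (hmul.eventually (by simp)).mono fun q h => h.differentiableAt (by simp)
  have dR := (hR.eventually (by simp)).mono fun q h => h.differentiableAt (by simp)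
  have dP := (hP.eventually (by simp)).mono fun q h => h.differentiableAt (by simp)
  have ds := (hs.eventually (by simp)).mono fun q h => h.differentiableAt (by simp)
  have cs : Tendsto s (𝓝 y₀) (𝓝 (s y₀)) := hs.continuousAt
  have cse : Tendsto (fun z => (s z, s y₀)) (𝓝 y₀) (𝓝 (s y₀, s y₀)) :=
    cs.prodMk_nhds tendsto_const_nhds
  have hA0 : ∀ᶠ z in 𝓝 y₀, A (s z) = 0 := by
    filter_upwards [hDE, cs.eventually dR, cse.eventually dmul, cs.eventually hmul_one]
      with z h1 h2 h3 h4
    have k1 := (hasFDerivAt_sndFDeriv h3).comp y₀ ds.self_of_nhds.hasFDerivAt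
    have k2 : HasFDerivAt (fun a => s (P a)) (fderiv ℝ (fun a => s (P a)) (s z))
      (mul (s z, s y₀)) := by rw [h4]; exact h2.hasFDerivAt
    have k3 := k2.comp y₀ k1
    have e1 := k1.fderiv
    have e2 := k3.fderiv
    simp only [Function.comp_def] at e1 e2
    rw [e1, e2] at h1
    simp only [A, ContinuousLinearMap.sub_comp, ContinuousLinearMap.id_comp]
    rw [sub_eq_zero]
    exact h1
  let T : F → F →L[ℝ] F := fun z =>
    (fderiv ℝ P (s z)).comp ((sndFDeriv mul (s z, s y₀)).comp L)
  have hT : ContinuousAt T y₀ := by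
    have h1 : ContinuousAt (fun z => fderiv ℝ P (s z)) y₀ :=
      (hP.fderiv_right (m := 1) (by norm_num)).continuousAt.comp hs.continuousAt
    have h2 : ContinuousAt (fun z => sndFDeriv mul (s z, s y₀)) y₀ :=
      ContinuousAt.comp (f := s) (x := y₀) (g := fun a => sndFDeriv mul (a, s y₀))
        hB.continuousAt hs.continuousAt
    exact h1.clm_comp (h2.clm_comp continuousAt_const)
  -- Left translation by `e` is the identity, so `T y₀` is the derivative of `P ∘ s = id`.
  have hT1 : T y₀ = 1 := by
    have h1 : sndFDeriv mul (s y₀, s y₀) = ContinuousLinearMap.id ℝ E :=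
      (hasFDerivAt_sndFDeriv dmul.self_of_nhds).unique
        ((hasFDerivAt_id (s y₀)).congr_of_eventuallyEq hone_mul)
    have h2 := dP.self_of_nhds.hasFDerivAt.comp y₀ ds.self_of_nhds.hasFDerivAt
    have h3 := h2.unique ((hasFDerivAt_id y₀).congr_of_eventuallyEq hPs)
    simp only [T, h1, ContinuousLinearMap.id_comp]
    exact h3
  have hu : IsUnit (T y₀) := by rw [hT1]; exact isUnit_one
  have hTu : ∀ᶠ z in 𝓝 y₀, IsUnit (T z) := hT.eventually (Units.isOpen.mem_nhds hu)
  have hS : ContinuousAt (fun z => Ring.inverse (T z)) y₀ := by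
    refine ContinuousAt.comp (g := Ring.inverse) (f := T) ?_ hT
    obtain ⟨u, hu⟩ := hu
    rw [← hu]
    exact NormedRing.inverse_continuousAt u
  obtain ⟨C, hC⟩ : ∃ C : ℝ, ∀ᶠ z in 𝓝 y₀, ‖Ring.inverse (T z)‖ ≤ C :=
    ⟨_, (hS.norm.eventually_lt_const (lt_add_one _)).mono fun _ h => h.le⟩
  -- By the chain rule, `A (s z) = 0` reads `Ds(z) T(z) = B(s z) L`; now invert `T(z)`.
  have hds : ∀ᶠ z in 𝓝 y₀, fderiv ℝ s z =
      ((sndFDeriv mul (s z, s y₀)).comp L).comp (Ring.inverse (T z)) := by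
    filter_upwards [hA0, hTu, ds, cs.eventually dP, hPs] with z h1 h2 h3 h4 h5
    have h3' : HasFDerivAt s (fderiv ℝ s z) (P (s z)) := by rw [h5]; exact h3.hasFDerivAt
    have k1 : fderiv ℝ (fun a => s (P a)) (s z) = _ := (h3'.comp (s z) h4.hasFDerivAt).fderiv
    simp only [A, ContinuousLinearMap.sub_comp, ContinuousLinearMap.id_comp] at h1
    rw [sub_eq_zero, k1] at h1
    rw [← h1]
    have k2 : (T z).comp (Ring.inverse (T z)) = ContinuousLinearMap.id ℝ F :=
      Ring.mul_inverse_cancel _ h2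
    calc fderiv ℝ s z = (fderiv ℝ s z).comp ((T z).comp (Ring.inverse (T z))) := by
          rw [k2, ContinuousLinearMap.comp_id]
      _ = _ := rfl
  have hassoc' := eventually_sndFDeriv_comp dmul hmul_one hassoc
  have css : Tendsto (fun q : F × F => (s q.1, s q.2)) (𝓝 (y₀, y₀)) (𝓝 (s y₀, s y₀)) :=
    (cs.comp (continuous_fst.tendsto' (y₀, y₀) _ rfl)).prodMk_nhds
      (cs.comp (continuous_snd.tendsto' (y₀, y₀) _ rfl))
  have cg : Tendsto (fun q : F × F => mul (s q.1, s q.2)) (𝓝 (y₀, y₀)) (𝓝 (s y₀)) := by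
    have : Tendsto mul (𝓝 (s y₀, s y₀)) (𝓝 (s y₀)) := by
      simpa [ContinuousAt, hee] using hmul.continuousAt
    exact this.comp css
  have cPg : Tendsto (fun q : F × F => P (mul (s q.1, s q.2))) (𝓝 (y₀, y₀)) (𝓝 y₀) := by
    have : Tendsto P (𝓝 (s y₀)) (𝓝 y₀) := by
      simpa [ContinuousAt, hPy] using hP.continuousAt
    exact this.comp cg
  have c2 : Tendsto (fun q : F × F => q.2) (𝓝 (y₀, y₀)) (𝓝 y₀) := continuous_snd.tendsto' _ _ rfl
  have c1 : Tendsto (fun q : F × F => q.1) (𝓝 (y₀, y₀)) (𝓝 y₀) := continuous_fst.tendsto' _ _ rfl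
  have key : ∀ᶠ q : F × F in 𝓝 (y₀, y₀), ∃ f' : F →L[ℝ] E,
      HasFDerivAt (fun z => s (P (mul (s q.1, s z))) - mul (s q.1, s z)) f' q.2 ∧
      ‖f'‖ ≤ (K * C) * ‖s (P (mul (s q.1, s q.2))) - mul (s q.1, s q.2)‖ := by
    filter_upwards [css.eventually dmul, cg.eventually dR, c2.eventually ds, c2.eventually hds,
      c2.eventually hC, css.eventually hassoc', cg.eventually ht, cPg.eventually (cs.eventually ht),
      cPg.eventually hA0] with q h1 h2 h3 h4 h5 h6 h7 h8 h9
    have k1 : HasFDerivAt (fun z => mul (s q.1, s z)) _ q.2 :=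
      (hasFDerivAt_sndFDeriv h1).comp q.2 h3.hasFDerivAt
    have k2 : HasFDerivAt (fun z => s (P (mul (s q.1, s z)))) _ q.2 :=
      HasFDerivAt.comp (g := fun a => s (P a)) q.2 h2.hasFDerivAt k1
    have hf : (fderiv ℝ (fun a => s (P a)) (mul (s q.1, s q.2))).comp
          ((sndFDeriv mul (s q.1, s q.2)).comp (fderiv ℝ s q.2)) -
        (sndFDeriv mul (s q.1, s q.2)).comp (fderiv ℝ s q.2) =
        (A (mul (s q.1, s q.2))).comp (Ring.inverse (T q.2)) := by
      rw [h4]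
      simp only [A, ← h6]
      ext v
      simp
    refine ⟨_, (k2.sub k1), ?_⟩
    rw [hf]
    -- Compare `A` at the product with its zero value at `s (P ·)` of the product, a point in the
    -- image of `s`.
    have hn : ‖A (mul (s q.1, s q.2))‖ ≤ K * ‖s (P (mul (s q.1, s q.2))) - mul (s q.1, s q.2)‖ := by
      have := hKt.norm_sub_le h8 h7
      rwa [h9, zero_sub, norm_neg] at this
    calc _ ≤ ‖A (mul (s q.1, s q.2))‖ * ‖Ring.inverse (T q.2)‖ :=
          ContinuousLinearMap.opNorm_comp_le _ _
      _ ≤ (K * ‖s (P (mul (s q.1, s q.2))) - mul (s q.1, s q.2)‖) * C := by gcongr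
      _ = _ := by ring
  have hstart : ∀ᶠ q : F × F in 𝓝 (y₀, y₀),
      s (P (mul (s q.1, s y₀))) - mul (s q.1, s y₀) = 0 := by
    filter_upwards [c1.eventually hPs, (cs.comp c1).eventually hmul_one] with q h1 h2
    simp only [Function.comp_apply] at h2
    rw [h2, h1, sub_self]
  obtain ⟨r, hr, hball⟩ := Metric.eventually_nhds_iff_ball.1 (key.and hstart)
  refine Metric.eventually_nhds_iff_ball.2 ⟨r, hr, fun q hq => ?_⟩
  have hq' := hq
  rw [← ball_prod_same] at hq'
  have hmem : ∀ z ∈ Metric.ball y₀ r, (q.1, z) ∈ Metric.ball (y₀, y₀) r := fun z hz => by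
    rw [← ball_prod_same]; exact ⟨hq'.1, hz⟩
  -- The derivative must be a total function of `z`; its value 0 off the ball is arbitrary.
  have H : ∀ z : F, ∃ f' : F →L[ℝ] E, z ∈ Metric.ball y₀ r →
      HasFDerivAt (fun z => s (P (mul (s q.1, s z))) - mul (s q.1, s z)) f' z ∧
      ‖f'‖ ≤ (K * C) * ‖s (P (mul (s q.1, s z))) - mul (s q.1, s z)‖ := fun z => by
    by_cases hz : z ∈ Metric.ball y₀ r
    · obtain ⟨f', h⟩ := (hball _ (hmem z hz)).1
      exact ⟨f', fun _ => h⟩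
    · exact ⟨0, fun h => (hz h).elim⟩
  choose f' hf' using H
  exact sub_eq_zero.1 ((convex_ball y₀ r).eq_zero_of_norm_fderiv_le
    (fun z hz => (hf' z hz).1) (fun z hz => (hf' z hz).2) (Metric.mem_ball_self hr) hq'.2
    (hball q hq).2)

end LocalMultiplication

/-! ### Transfer between manifolds and charts. -/

section Manifold

open Filter Set

/-- Foot points such as `σ x * σ x₀` and `σ x` agree only propositionally. Typing derivatives on the
model spaces lets the chain rule move between them. -/
theorem HasMFDerivAt.congr_basepoint {E E' H H' M M' : Type*}
    [NormedAddCommGroup E] [NormedSpace ℝ E] [NormedAddCommGroup E'] [NormedSpace ℝ E']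
    [TopologicalSpace H] [TopologicalSpace H'] {I : ModelWithCorners ℝ E H}
    {I' : ModelWithCorners ℝ E' H'} [TopologicalSpace M] [ChartedSpace H M]
    [TopologicalSpace M'] [ChartedSpace H' M'] {f : M → M'} {x y : M} {f' : E →L[ℝ] E'}
    (hf : HasMFDerivAt I I' f x f') (h : x = y) : HasMFDerivAt I I' f y f' := by
  subst h; exact hf

variable {n m : ℕ}
  {G : Type*} [TopologicalSpace G] [ChartedSpace (EuclideanSpace ℝ (Fin n)) G]
  [Group G] [LieGroup (𝓡 n) ∞ G]
  {M : Type*} [TopologicalSpace M] [ChartedSpace (EuclideanSpace ℝ (Fin m)) M]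
  {U : Set G} {p : G → M} {x₀ : M} {V : Set M} {σ : M → G}

theorem hasMFDerivAt_mul_section
    (hV : IsOpen V) (hx₀V : x₀ ∈ V) (hσ : IsSmoothSectionOn n m U p V σ) (hσx₀ : σ x₀ = 1)
    (g : G) :
    HasMFDerivAt (𝓡 m) (𝓡 n) (fun y => g * σ y) x₀
      (ContinuousLinearMap.comp (M₁ := EuclideanSpace ℝ (Fin m)) (M₂ := EuclideanSpace ℝ (Fin n))
        (M₃ := EuclideanSpace ℝ (Fin n))
        (mfderiv (𝓡 n) (𝓡 n) (fun h : G => g * h) 1) (mfderiv (𝓡 m) (𝓡 n) σ x₀)) := by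
  have h1 : HasMFDerivAt (𝓡 n) (𝓡 n) (fun h : G => g * h) 1
      (mfderiv (𝓡 n) (𝓡 n) (fun h : G => g * h) 1) :=
    ((contMDiff_mul_left (I := 𝓡 n) (n := ∞) (a := g)).mdifferentiable
      (by simp) 1).hasMFDerivAt
  have h2 : HasMFDerivAt (𝓡 m) (𝓡 n) σ x₀ (mfderiv (𝓡 m) (𝓡 n) σ x₀) :=
    ((hσ.contMDiffOn.contMDiffAt (hV.mem_nhds hx₀V)).mdifferentiableAt (by simp)).hasMFDerivAt
  exact HasMFDerivAt.comp x₀ (h1.congr_basepoint hσx₀.symm) h2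

theorem hasMFDerivAt_section_mul_section (hU : IsOpen U) (hp : IsSmoothFibrationOn n m U p)
    (hV : IsOpen V) (hx₀V : x₀ ∈ V) (hσ : IsSmoothSectionOn n m U p V σ) (hσx₀ : σ x₀ = 1)
    {x : M} (hx : x ∈ V) :
    HasMFDerivAt (𝓡 m) (𝓡 n) (fun y => σ (p (σ x * σ y))) x₀
      (ContinuousLinearMap.comp (M₁ := EuclideanSpace ℝ (Fin m)) (M₂ := EuclideanSpace ℝ (Fin m))
        (M₃ := EuclideanSpace ℝ (Fin n))
        (mfderiv (𝓡 m) (𝓡 n) σ x)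
        (ContinuousLinearMap.comp (M₁ := EuclideanSpace ℝ (Fin m))
          (M₂ := EuclideanSpace ℝ (Fin n)) (M₃ := EuclideanSpace ℝ (Fin m))
          (mfderiv (𝓡 n) (𝓡 m) p (σ x))
          (ContinuousLinearMap.comp (M₁ := EuclideanSpace ℝ (Fin m))
            (M₂ := EuclideanSpace ℝ (Fin n)) (M₃ := EuclideanSpace ℝ (Fin n))
            (mfderiv (𝓡 n) (𝓡 n) (fun h : G => σ x * h) 1) (mfderiv (𝓡 m) (𝓡 n) σ x₀)))) := by
  have h2 : HasMFDerivAt (𝓡 n) (𝓡 m) p (σ x) (mfderiv (𝓡 n) (𝓡 m) p (σ x)) :=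
    ((hp.contMDiffOn.contMDiffAt (hU.mem_nhds (hσ.mapsTo hx))).mdifferentiableAt
      (by simp)).hasMFDerivAt
  have h3 : HasMFDerivAt (𝓡 m) (𝓡 n) σ x (mfderiv (𝓡 m) (𝓡 n) σ x) :=
    ((hσ.contMDiffOn.contMDiffAt (hV.mem_nhds hx)).mdifferentiableAt (by simp)).hasMFDerivAt
  have e1 : σ x = σ x * σ x₀ := by rw [hσx₀, mul_one]
  have e2 : x = p (σ x * σ x₀) := by rw [← e1, hσ.rightInv x hx]
  exact HasMFDerivAt.comp x₀ (h3.congr_basepoint e2)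
    (HasMFDerivAt.comp x₀ (h2.congr_basepoint e1) (hasMFDerivAt_mul_section hV hx₀V hσ hσx₀ (σ x)))

/-- The differential equation at `x` says that both sides of the functional equation, as functions
of the second argument, have the same derivative at `x₀`. -/
theorem differentialEquationAt_iff (hU : IsOpen U) (hp : IsSmoothFibrationOn n m U p)
    (hV : IsOpen V) (hx₀V : x₀ ∈ V) (hσ : IsSmoothSectionOn n m U p V σ) (hσx₀ : σ x₀ = 1)
    {x : M} (hx : x ∈ V) :
    DifferentialEquationAt n m p σ x₀ x ↔
      ∃ f' : EuclideanSpace ℝ (Fin m) →L[ℝ] EuclideanSpace ℝ (Fin n),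
        HasMFDerivAt (𝓡 m) (𝓡 n) (fun y => σ (p (σ x * σ y))) x₀ f' ∧
        HasMFDerivAt (𝓡 m) (𝓡 n) (fun y => σ x * σ y) x₀ f' := by
  have h1 := hasMFDerivAt_section_mul_section hU hp hV hx₀V hσ hσx₀ hx
  have h2 := hasMFDerivAt_mul_section hV hx₀V hσ hσx₀ (σ x)
  constructor
  · intro h
    refine ⟨_, h1, ?_⟩
    have clm_ext : ∀ A B : EuclideanSpace ℝ (Fin m) →L[ℝ] EuclideanSpace ℝ (Fin n),
        (∀ ξ, A ξ = B ξ) → A = B := fun _ _ => ContinuousLinearMap.ext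
    refine h2.congr_mfderiv (clm_ext _ _ ?_)
    exact fun ξ => (h ξ).symm
  · rintro ⟨f', k1, k2⟩
    have e1 := hasMFDerivAt_unique h1 k1
    have e2 := hasMFDerivAt_unique h2 k2
    exact fun ξ => DFunLike.congr_fun (e1.trans e2.symm) ξ

theorem SolvesFunctionalEquationNear.solvesDifferentialEquationNear
    (hU : IsOpen U) (hp : IsSmoothFibrationOn n m U p)
    (hV : IsOpen V) (hx₀V : x₀ ∈ V) (hσ : IsSmoothSectionOn n m U p V σ) (hσx₀ : σ x₀ = 1)
    (h : SolvesFunctionalEquationNear U p V σ x₀) :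
    SolvesDifferentialEquationNear n m p V σ x₀ := by
  obtain ⟨W, hW, hxW, hWV, h⟩ := h
  refine ⟨W, hW, hxW, hWV, fun x hx => ?_⟩
  rw [differentialEquationAt_iff hU hp hV hx₀V hσ hσx₀ (hWV hx)]
  have h2 := hasMFDerivAt_mul_section hV hx₀V hσ hσx₀ (σ x)
  refine ⟨_, h2.congr_of_eventuallyEq ?_, h2⟩
  filter_upwards [hW.mem_nhds hxW] with y hy using (h x hx y hy).2.2

theorem SolvesDifferentialEquationNear.solvesFunctionalEquationNear [IsManifold (𝓡 m) ∞ M]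
    (hU : IsOpen U) (hp : IsSmoothFibrationOn n m U p)
    (hV : IsOpen V) (hx₀V : x₀ ∈ V) (hσ : IsSmoothSectionOn n m U p V σ) (hσx₀ : σ x₀ = 1)
    (h : SolvesDifferentialEquationNear n m p V σ x₀) :
    SolvesFunctionalEquationNear U p V σ x₀ := by
  have : IsTopologicalGroup G := topologicalGroup_of_lieGroup (𝓡 n) ∞
  have heU : (1 : G) ∈ U := hσx₀ ▸ hσ.mapsTo hx₀V
  have hp1 : p 1 = x₀ := by rw [← hσx₀, hσ.rightInv x₀ hx₀V]
  set φ := extChartAt (𝓡 n) (1 : G) with hφ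
  set ψ := extChartAt (𝓡 m) x₀ with hψ
  -- smoothness of the charts and their inverses
  have sφ : ContMDiffAt (𝓡 n) 𝓘(ℝ, EuclideanSpace ℝ (Fin n)) ∞ φ 1 := contMDiffAt_extChartAt
  have sψ : ContMDiffAt (𝓡 m) 𝓘(ℝ, EuclideanSpace ℝ (Fin m)) ∞ ψ x₀ := contMDiffAt_extChartAt
  have sφ' : ContMDiffAt 𝓘(ℝ, EuclideanSpace ℝ (Fin n)) (𝓡 n) ∞ φ.symm (φ 1) :=
    (contMDiffOn_extChartAt_symm (1 : G)).contMDiffAt (extChartAt_target_mem_nhds 1)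
  have sψ' : ContMDiffAt 𝓘(ℝ, EuclideanSpace ℝ (Fin m)) (𝓡 m) ∞ ψ.symm (ψ x₀) :=
    (contMDiffOn_extChartAt_symm x₀).contMDiffAt (extChartAt_target_mem_nhds x₀)
  have e1 : φ.symm (φ 1) = 1 := extChartAt_to_inv (I := 𝓡 n) (1 : G)
  have e2 : ψ.symm (ψ x₀) = x₀ := extChartAt_to_inv (I := 𝓡 m) x₀
  have sσ : ContMDiffAt (𝓡 m) (𝓡 n) ∞ σ x₀ := hσ.contMDiffOn.contMDiffAt (hV.mem_nhds hx₀V)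
  have sp : ContMDiffAt (𝓡 n) (𝓡 m) ∞ p 1 := hp.contMDiffOn.contMDiffAt (hU.mem_nhds heU)
  -- limits at the base points
  have tσ : Tendsto σ (𝓝 x₀) (𝓝 1) := by simpa [ContinuousAt, hσx₀] using sσ.continuousAt
  have tp : Tendsto p (𝓝 1) (𝓝 x₀) := by simpa [ContinuousAt, hp1] using sp.continuousAt
  have tφ : Tendsto φ (𝓝 1) (𝓝 (φ 1)) := sφ.continuousAt
  have tψ : Tendsto ψ (𝓝 x₀) (𝓝 (ψ x₀)) := sψ.continuousAt
  have tφ' : Tendsto φ.symm (𝓝 (φ 1)) (𝓝 1) := by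
    simpa [ContinuousAt, e1] using sφ'.continuousAt
  have tψ' : Tendsto ψ.symm (𝓝 (ψ x₀)) (𝓝 x₀) := by
    simpa [ContinuousAt, e2] using sψ'.continuousAt
  have tmul : Tendsto (fun q : G × G => q.1 * q.2) (𝓝 (1, 1)) (𝓝 1) :=
    continuous_mul.tendsto' _ _ (mul_one 1)
  have iφ : ∀ᶠ g in 𝓝 (1 : G), φ.symm (φ g) = g := by
    filter_upwards [extChartAt_source_mem_nhds (I := 𝓡 n) (1 : G)] with g hg using φ.left_inv hg
  have iψ : ∀ᶠ x in 𝓝 x₀, ψ.symm (ψ x) = x := by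
    filter_upwards [extChartAt_source_mem_nhds (I := 𝓡 m) x₀] with g hg using ψ.left_inv hg
  have iφ' : ∀ᶠ a in 𝓝 (φ 1), φ (φ.symm a) = a := by
    filter_upwards [extChartAt_target_mem_nhds (I := 𝓡 n) (1 : G)] with g hg using φ.right_inv hg
  have iψ' : ∀ᶠ a in 𝓝 (ψ x₀), ψ (ψ.symm a) = a := by
    filter_upwards [extChartAt_target_mem_nhds (I := 𝓡 m) x₀] with g hg using ψ.right_inv hg
  -- the data in coordinates
  let mul : EuclideanSpace ℝ (Fin n) × EuclideanSpace ℝ (Fin n) → EuclideanSpace ℝ (Fin n) :=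
    fun q => φ (φ.symm q.1 * φ.symm q.2)
  let s : EuclideanSpace ℝ (Fin m) → EuclideanSpace ℝ (Fin n) := fun z => φ (σ (ψ.symm z))
  let P : EuclideanSpace ℝ (Fin n) → EuclideanSpace ℝ (Fin m) := fun a => ψ (p (φ.symm a))
  have hse : s (ψ x₀) = φ 1 := by simp only [s, e2, hσx₀]
  have cs : ContDiffAt ℝ ∞ s (ψ x₀) := by
    refine ContMDiffAt.contDiffAt ?_
    exact ContMDiffAt.comp_of_eq sφ (ContMDiffAt.comp_of_eq sσ sψ' e2)
      (by simp only [e2, hσx₀])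
  have cP : ContDiffAt ℝ ∞ P (φ 1) := by
    refine ContMDiffAt.contDiffAt ?_
    exact ContMDiffAt.comp_of_eq sψ (ContMDiffAt.comp_of_eq sp sφ' e1)
      (by simp only [e1, hp1])
  have cmul : ContDiffAt ℝ ∞ mul (φ 1, φ 1) := by
    refine ContMDiffAt.contDiffAt ?_
    refine ContMDiffAt.comp_of_eq (f := fun q : EuclideanSpace ℝ (Fin n) ×
      EuclideanSpace ℝ (Fin n) => φ.symm q.1 * φ.symm q.2) sφ ?_ (by simp only [e1, mul_one])
    exact ContMDiffAt.mul (ContMDiffAt.comp_of_eq sφ' contDiff_fst.contMDiff.contMDiffAt rfl)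
      (ContMDiffAt.comp_of_eq sφ' contDiff_snd.contMDiff.contMDiffAt rfl)
  have ts : Tendsto (fun z => σ (ψ.symm z)) (𝓝 (ψ x₀)) (𝓝 1) := tσ.comp tψ'
  have hPs : ∀ᶠ z in 𝓝 (ψ x₀), P (s z) = z := by
    filter_upwards [ts.eventually iφ, tψ'.eventually (hV.mem_nhds hx₀V), iψ'] with z h1 h2 h3
    simp only [P, s]
    rw [h1, hσ.rightInv _ h2, h3]
  have hmul_one : ∀ᶠ a in 𝓝 (φ 1), mul (a, φ 1) = a := by
    filter_upwards [iφ'] with a ha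
    simp only [mul, e1, mul_one, ha]
  have hone_mul : ∀ᶠ a in 𝓝 (φ 1), mul (φ 1, a) = a := by
    filter_upwards [iφ'] with a ha
    simp only [mul, e1, one_mul, ha]
  have tmulφ : Tendsto (fun q : EuclideanSpace ℝ (Fin n) × EuclideanSpace ℝ (Fin n) =>
      φ.symm q.1 * φ.symm q.2) (𝓝 (φ 1, φ 1)) (𝓝 1) :=
    tmul.comp ((tφ'.comp (continuous_fst.tendsto' (φ 1, φ 1) (φ 1) rfl)).prodMk_nhds
      (tφ'.comp (continuous_snd.tendsto' (φ 1, φ 1) (φ 1) rfl)))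
  have hmulφ := tmulφ.eventually iφ
  have hassoc : ∀ᶠ q : (EuclideanSpace ℝ (Fin n) × EuclideanSpace ℝ (Fin n)) ×
      EuclideanSpace ℝ (Fin n) in 𝓝 ((φ 1, φ 1), φ 1),
      mul (mul (q.1.1, q.1.2), q.2) = mul (q.1.1, mul (q.1.2, q.2)) := by
    have t1 : Tendsto (fun q : (EuclideanSpace ℝ (Fin n) × EuclideanSpace ℝ (Fin n)) ×
      EuclideanSpace ℝ (Fin n) => q.1) (𝓝 ((φ 1, φ 1), φ 1)) (𝓝 (φ 1, φ 1)) :=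
      continuous_fst.tendsto' _ _ rfl
    have t2 : Tendsto (fun q : (EuclideanSpace ℝ (Fin n) × EuclideanSpace ℝ (Fin n)) ×
      EuclideanSpace ℝ (Fin n) => (q.1.2, q.2)) (𝓝 ((φ 1, φ 1), φ 1)) (𝓝 (φ 1, φ 1)) :=
      (by fun_prop : Continuous _).tendsto' _ _ rfl
    filter_upwards [t1.eventually hmulφ, t2.eventually hmulφ] with q h1 h2
    simp only [mul]
    rw [h1, h2, mul_assoc]
  obtain ⟨W, hW, hxW, hWV, hDE⟩ := h
  have hDE' : ∀ᶠ z in 𝓝 (ψ x₀), fderiv ℝ (fun y => s (P (mul (s z, s y)))) (ψ x₀) =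
      fderiv ℝ (fun y => mul (s z, s y)) (ψ x₀) := by
    have tpair : Tendsto (fun q : EuclideanSpace ℝ (Fin m) × EuclideanSpace ℝ (Fin m) =>
        σ (ψ.symm q.1) * σ (ψ.symm q.2)) (𝓝 (ψ x₀, ψ x₀)) (𝓝 1) :=
      tmul.comp ((ts.comp (continuous_fst.tendsto' (ψ x₀, ψ x₀) (ψ x₀) rfl)).prodMk_nhds
        (ts.comp (continuous_snd.tendsto' (ψ x₀, ψ x₀) (ψ x₀) rfl)))
    have hpair := tpair.eventually (iφ.and (tp.eventually iψ))
    rw [nhds_prod_eq] at hpair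
    have hsrc := ts.eventually (extChartAt_source_mem_nhds (I := 𝓡 n) (1 : G))
    filter_upwards [ts.eventually iφ, hpair.curry, tψ'.eventually (hW.mem_nhds hxW), hsrc]
      with z h1 h2 h3 h4
    set x := ψ.symm z
    have hx : x ∈ V := hWV h3
    obtain ⟨f', k1, k2⟩ :=
      (differentialEquationAt_iff hU hp hV hx₀V hσ hσx₀ hx).1 (hDE x h3)
    have b2 : σ x * σ x₀ = σ x := by rw [hσx₀, mul_one]
    have b1 : σ (p (σ x * σ x₀)) = σ x := by rw [b2, hσ.rightInv x hx]
    have dφ : HasMFDerivAt (𝓡 n) 𝓘(ℝ, EuclideanSpace ℝ (Fin n)) φ (σ x)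
        (mfderiv (𝓡 n) 𝓘(ℝ, EuclideanSpace ℝ (Fin n)) φ (σ x)) :=
      (mdifferentiableAt_extChartAt (by rwa [extChartAt_source] at h4)).hasMFDerivAt
    have dψ : HasMFDerivAt 𝓘(ℝ, EuclideanSpace ℝ (Fin m)) (𝓡 m) ψ.symm (ψ x₀)
        (mfderiv 𝓘(ℝ, EuclideanSpace ℝ (Fin m)) (𝓡 m) ψ.symm (ψ x₀)) :=
      (sψ'.mdifferentiableAt (by simp)).hasMFDerivAt
    let D : EuclideanSpace ℝ (Fin m) →L[ℝ] EuclideanSpace ℝ (Fin n) :=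
      ContinuousLinearMap.comp (M₁ := EuclideanSpace ℝ (Fin m))
        (M₂ := EuclideanSpace ℝ (Fin n)) (M₃ := EuclideanSpace ℝ (Fin n))
        (mfderiv (𝓡 n) 𝓘(ℝ, EuclideanSpace ℝ (Fin n)) φ (σ x))
        (ContinuousLinearMap.comp (M₁ := EuclideanSpace ℝ (Fin m))
          (M₂ := EuclideanSpace ℝ (Fin m)) (M₃ := EuclideanSpace ℝ (Fin n)) f'
          (mfderiv 𝓘(ℝ, EuclideanSpace ℝ (Fin m)) (𝓡 m) ψ.symm (ψ x₀)))
    -- Both sides of the functional equation take the value `σ x` at `x₀`, so the same chart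
    -- derivatives convert both, to the same `D`.
    have in_coordinates : ∀ {f : M → G}, HasMFDerivAt (𝓡 m) (𝓡 n) f x₀ f' → f x₀ = σ x →
        HasFDerivAt (fun y => φ (f (ψ.symm y))) D (ψ x₀) := by
      intro f hf hfx
      refine HasMFDerivAt.hasFDerivAt ?_
      exact HasMFDerivAt.comp (ψ x₀) (dφ.congr_basepoint (by simp only [e2, hfx]))
        (HasMFDerivAt.comp (ψ x₀) (hf.congr_basepoint e2.symm) dψ)
    have j1 := in_coordinates k1 b1
    have j2 := in_coordinates k2 b2
    have c1 : (fun y => s (P (mul (s z, s y)))) =ᶠ[𝓝 (ψ x₀)]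
        fun y => φ (σ (p (σ x * σ (ψ.symm y)))) := by
      filter_upwards [h2, ts.eventually iφ] with y l1 l2
      simp only [s, P, mul]
      rw [h1, l2, l1.1, l1.2]
    have c2 : (fun y => mul (s z, s y)) =ᶠ[𝓝 (ψ x₀)] fun y => φ (σ x * σ (ψ.symm y)) := by
      filter_upwards [ts.eventually iφ] with y l2
      simp only [s, mul]
      rw [h1, l2]
    rw [(j1.congr_of_eventuallyEq c1).fderiv, (j2.congr_of_eventuallyEq c2).fderiv]
  have two_le : (2 : WithTop ℕ∞) ≤ ∞ := WithTop.coe_le_coe.2 (le_top : (2 : ℕ∞) ≤ ⊤)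
  have key := eventually_section_mul (cmul.of_le two_le) (cs.of_le two_le) (cP.of_le two_le)
    hse hPs hmul_one hone_mul hassoc hDE'
  have t1 : Tendsto (fun q : M × M => q.1) (𝓝 (x₀, x₀)) (𝓝 x₀) := continuous_fst.tendsto' _ _ rfl
  have t2 : Tendsto (fun q : M × M => q.2) (𝓝 (x₀, x₀)) (𝓝 x₀) := continuous_snd.tendsto' _ _ rfl
  have tm : Tendsto (fun q : M × M => σ q.1 * σ q.2) (𝓝 (x₀, x₀)) (𝓝 1) :=
    tmul.comp ((tσ.comp t1).prodMk_nhds (tσ.comp t2))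
  have tσp : Tendsto (fun g => σ (p g)) (𝓝 1) (𝓝 1) := tσ.comp tp
  have final : ∀ᶠ q : M × M in 𝓝 (x₀, x₀),
      σ q.1 * σ q.2 ∈ U ∧ p (σ q.1 * σ q.2) ∈ V ∧
        σ (p (σ q.1 * σ q.2)) = σ q.1 * σ q.2 := by
    filter_upwards [((tψ.comp t1).prodMk_nhds (tψ.comp t2)).eventually key,
      t1.eventually iψ, t2.eventually iψ, t1.eventually (tσ.eventually iφ),
      t2.eventually (tσ.eventually iφ), tm.eventually iφ, tm.eventually (tp.eventually iψ),
      tm.eventually (tσp.eventually iφ), tm.eventually (hU.mem_nhds heU),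
      tm.eventually (tp.eventually (hV.mem_nhds hx₀V))] with q l1 l2 l3 l4 l5 l6 l7 l8 l9 l10
    refine ⟨l9, l10, ?_⟩
    simp only [s, P, mul, Function.comp_apply] at l1
    rw [l2, l3, l4, l5, l6, l7] at l1
    -- Both sides lie near `1`, where `φ.symm` undoes `φ`, so equality in coordinates gives equality
    -- in `G`.
    rw [← l8, l1, l6]
  rw [nhds_prod_eq] at final
  obtain ⟨W', hW', hfinal⟩ := eventually_prod_self_iff'.1 final
  obtain ⟨O, hO, hOo, hxO⟩ := mem_nhds_iff.1 hW'
  exact ⟨O ∩ V, hOo.inter hV, ⟨hxO, hx₀V⟩, inter_subset_right,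
    fun x hx y hy => hfinal x (hO hx.1) y (hO hy.1)⟩

end Manifold

theorem theorem1 {n m : ℕ}
    {G : Type*} [TopologicalSpace G] [T2Space G] [ChartedSpace (EuclideanSpace ℝ (Fin n)) G]
    [Group G] [LieGroup (𝓡 n) ∞ G]
    {M : Type*} [TopologicalSpace M] [T2Space M] [ChartedSpace (EuclideanSpace ℝ (Fin m)) M]
    [IsManifold (𝓡 m) ∞ M]
    (U : Set G) (hU : IsOpen U) (heU : (1 : G) ∈ U)
    (p : G → M) (hp : IsSmoothFibrationOn n m U p)
    (x₀ : M) (hx₀ : x₀ = p 1)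
    (V : Set M) (hV : IsOpen V) (hx₀V : x₀ ∈ V)
    (σ : M → G) (hσ : IsSmoothSectionOn n m U p V σ) (hσx₀ : σ x₀ = 1) :
    SolvesDifferentialEquationNear n m p V σ x₀ ↔ SolvesFunctionalEquationNear U p V σ x₀ :=
  ⟨fun h => h.solvesFunctionalEquationNear hU hp hV hx₀V hσ hσx₀,
    fun h => h.solvesDifferentialEquationNear hU hp hV hx₀V hσ hσx₀⟩
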